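/- **Setting.** Let $X$ be a compact Polish space. A *foliated chart* in $X$ is a homeomorphism $\varphi:U\to B\times S$ from an open set $U\subset X$ onto the product of an open ball $B$ of some $\mathbb R^m$ and a Polish space $S$; its *plaques* are the sets $\varphi^{-1}(B\times\{s\})$. Let $\mathcal F$ be a lamination on $X$, that is, a maximal family of foliated charts covering $X$ whose coordinate changes are locally of the form $(x,s)\mapsto(f(x,s),g(s))$. The plaques of the charts of $\mathcal F$ generate the leaf topology, whose connected components are the leaves; for an open set $U$, the leaves of $\mathcal F_U$ are the connected components of $U$ in the leaf topology. A *finite regular foliated atlas* of $\mathcal F$ is a finite family $\mathcal U\subset\mathcal F$ of charts whose domains cover $X$, such that (i) if a plaque $P$ of a chart of $\mathcal U$ meets the domain $U_j$ of another one, then $P\cap U_j$ is contained in a single plaque of the latter, and (ii) if the domains of two charts of $\mathcal U$ meet, then the union of these domains is contained in the domain $V$ of a chart of $\mathcal F$ such that, for each of the two charts, two points of its domain lie in the same plaque of that chart if and only if they lie in the same plaque of $V$. A *tangential contraction* of an open set $U$ is a continuous map $H:U\times\mathbb R\to X$ that maps each product of a leaf of $\mathcal F_U$ with $\mathbb R$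 into a leaf of $\mathcal F$, with $H(x,0)=x$ for all $x\in U$ and $H(\cdot,1)$ constant on each leaf of $\mathcal F_U$; $U$ is *categorical* if it has one. A *chain of plaques* of $\mathcal U$ is a finite sequence of plaques of charts of $\mathcal U$ each of which meets the next one. The *length* relative to $\mathcal U$ of a leafwise path is the minimum number of plaques in a chain of plaques of $\mathcal U$ whose union contains the path, and the length of $H$ is the supremum over $x\in U$ of the lengths of the paths $t\mapsto H(x,t)$, $t\in[0,1]$. Let $\Lambda$ be a transverse invariant measure of $\mathcal F$ (a Borel measure on the transverse spaces $S$ of the charts, invariant under holonomy) that is regular and finite on compact sets, extended to transverse sets (the Borel sets that meet each leaf in a countable set). Put $$\operatorname{Cat}(\mathcal F,\Lambda)=\inf_{\mathcal C}\sum_{U\in\mathcal C}\ \inf_H\Lambda\bigl(H(U\times\{1\})\bigr),$$ where $\mathcal C$ runs over the coverings of $X$ by categorical open sets and $H$ over the tangential contractions of $U$. For $n\in\mathbb N$, let $\operatorname{Cat}(\mathcal F,\Lambda,n,\mathcal U)$ be defined in the same way, using only tangential contractions of length $\le n$ relative to $\mathcal U$ (with $\inf\emptyset=\infty$). For non-decreasing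 sequences $g,h:\mathbb N\to[0,\infty]$ write $g\preceq h$ if there are $B\in\mathbb N$ and a real $A>0$ with $g(n)\le A\,h(Bn)$ for all $n$. The *growth type* of $g$ is its class for the equivalence relation $g\preceq h\preceq g$. **Proposition.** Suppose that $\operatorname{Cat}(\mathcal F,\Lambda)=0$. Then the secondary $\Lambda$-category $\operatorname{Cat}_{\mathrm{II}}(\mathcal F,\Lambda,\mathcal U)$, defined as the growth type of the non-decreasing sequence $n\mapsto 1/\operatorname{Cat}(\mathcal F,\Lambda,n,\mathcal U)$ (with $1/0=\infty$ and $1/\infty=0$), is independent of the choice of the finite regular foliated atlas $\mathcal U$: for any two finite regular foliated atlases $\mathcal U,\mathcal V$ of $\mathcal F$, $$\operatorname{Cat}_{\mathrm{II}}(\mathcal F,\Lambda,\mathcal U)=\operatorname{Cat}_{\mathrm{II}}(\mathcal F,\Lambda,\mathcal V).$$ -/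

import Mathlib

open Set Topology MeasureTheory
open scoped ENNReal NNReal

universe u

/-! ### Foliated charts and laminations -/

/-- A foliated chart in `X`: a homeomorphism `φ` from an open set of `X` onto `B × S`, where `B` is
an open ball of some `ℝⁿ` and `S` is a Polish space. -/
structure FoliatedChart (X : Type u) [TopologicalSpace X] where
  /-- the dimension of the plaques -/
  dim : ℕ
  /-- the transverse space -/
  S : Type u
  [topS : TopologicalSpace S]
  [polishS : PolishSpace S]
  center : EuclideanSpace ℝ (Fin dim)
  radius : ℝ
  radius_pos : 0 < radius
  φ : OpenPartialHomeomorph X (EuclideanSpace ℝ (Fin dim) × S)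
  target_eq : φ.target = Metric.ball center radius ×ˢ (univ : Set S)

namespace FoliatedChart

variable {X : Type u} [TopologicalSpace X]

instance (c : FoliatedChart X) : TopologicalSpace c.S := c.topS

instance (c : FoliatedChart X) : PolishSpace c.S := c.polishS

instance (c : FoliatedChart X) : MeasurableSpace c.S := borel c.S

instance (c : FoliatedChart X) : BorelSpace c.S := ⟨rfl⟩

/-- The domain of the chart. -/
def dom (c : FoliatedChart X) : Set X := c.φ.source

/-- The projection `U → S` associated to the chart (meaningful on the domain only). -/
def proj (c : FoliatedChart X) (x : X) : c.S := (c.φ x).2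

/-- The plaque `φ⁻¹(B × {s})` of the chart. -/
def plaque (c : FoliatedChart X) (s : c.S) : Set X := {x | x ∈ c.dom ∧ c.proj x = s}

/-- The changes of coordinates between the two charts preserve the plaques: in both directions they
are locally of the form `(x, s) ↦ (f (x, s), g s)`. Equivalently, each common point has a
neighbourhood in which lying on the same plaque means the same for both charts. -/
def Compatible (c d : FoliatedChart X) : Prop :=
  ∀ x ∈ c.dom ∩ d.dom, ∃ N : Set X, IsOpen N ∧ x ∈ N ∧ N ⊆ c.dom ∩ d.dom ∧
    ∀ y ∈ N, ∀ z ∈ N, c.proj y = c.proj z ↔ d.proj y = d.proj z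

end FoliatedChart

/-- A lamination on `X`: a maximal foliated atlas. -/
structure Lamination (X : Type u) [TopologicalSpace X] where
  charts : Set (FoliatedChart X)
  covers : ∀ x : X, ∃ c ∈ charts, x ∈ c.dom
  compatible : ∀ c ∈ charts, ∀ d ∈ charts, c.Compatible d
  maximal : ∀ c : FoliatedChart X, (∀ d ∈ charts, c.Compatible d) → c ∈ charts

namespace Lamination

variable {X : Type u} [TopologicalSpace X]

/-- The leaf topology: the topology generated by the plaques of all the charts. -/
@[reducible] def leafTopology (F : Lamination X) : TopologicalSpace X :=
  TopologicalSpace.generateFrom {P | ∃ c ∈ F.charts, ∃ s : c.S, P = c.plaque s}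

/-- The leaf through `x`: its connected component in the leaf topology. -/
def leaf (F : Lamination X) (x : X) : Set X :=
  @connectedComponent X F.leafTopology x

/-- The leaf through `x ∈ U` of the lamination that `F` induces on the open set `U`: the connected
component of `x` in `U`, for the leaf topology. -/
def leafIn (F : Lamination X) (U : Set X) (x : X) : Set X :=
  @connectedComponentIn X F.leafTopology U x

/-- `𝓤` is a finite regular foliated atlas of the lamination `F`. -/
structure IsFiniteRegularAtlas (F : Lamination X) (𝓤 : Set (FoliatedChart X)) : Prop where
  finite : 𝓤.Finite
  subset : 𝓤 ⊆ F.charts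
  covers : ∀ x : X, ∃ c ∈ 𝓤, x ∈ c.dom
  /-- each plaque of a chart meets any other chart inside a single plaque of the latter -/
  plaque_inter : ∀ c ∈ 𝓤, ∀ d ∈ 𝓤, ∀ s : c.S, (c.plaque s ∩ d.dom).Nonempty →
    ∃ t : d.S, c.plaque s ∩ d.dom ⊆ d.plaque t
  /-- any two charts that meet are restrictions, up to a change of the tangential coordinate, of a
  common chart of the lamination -/
  union_chart : ∀ c ∈ 𝓤, ∀ d ∈ 𝓤, (c.dom ∩ d.dom).Nonempty →
    ∃ v ∈ F.charts, c.dom ∪ d.dom ⊆ v.dom ∧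
      (∀ x ∈ c.dom, ∀ y ∈ c.dom, c.proj x = c.proj y ↔ v.proj x = v.proj y) ∧
      (∀ x ∈ d.dom, ∀ y ∈ d.dom, d.proj x = d.proj y ↔ v.proj x = v.proj y)

/-! ### Tangential deformations and contractions -/

/-- `H` restricts to a tangential homotopy `U × ℝ → X`: a continuous map that sends each leaf
`L × ℝ` of `U × ℝ`, with `L` a leaf of the restriction of `F` to `U`, into a leaf of `F`. The values
of `H` outside `U × ℝ` play no role. -/
def IsTangentialHomotopy (F : Lamination X) (U : Set X) (H : X → ℝ → X) : Prop :=
  ContinuousOn (fun p : X × ℝ => H p.1 p.2) (U ×ˢ (univ : Set ℝ)) ∧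
    ∀ x ∈ U, ∀ y ∈ F.leafIn U x, ∀ s t : ℝ, H y t ∈ F.leaf (H x s)

/-- A tangential homotopy that starts at the inclusion of `U`. -/
def IsTangentialDeformation (F : Lamination X) (U : Set X) (H : X → ℝ → X) : Prop :=
  F.IsTangentialHomotopy U H ∧ ∀ x ∈ U, H x 0 = x

/-- A tangential deformation whose final map is constant on the leaves of the restriction to `U`. -/
def IsTangentialContraction (F : Lamination X) (U : Set X) (H : X → ℝ → X) : Prop :=
  F.IsTangentialDeformation U H ∧ ∀ x ∈ U, ∀ y ∈ F.leafIn U x, H y 1 = H x 1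

/-- The open set `U` is tangentially categorical. -/
def IsCategorical (F : Lamination X) (U : Set X) : Prop :=
  IsOpen U ∧ ∃ H, F.IsTangentialContraction U H

end Lamination

/-! ### Leafwise lengths measured by an atlas -/

section Length

variable {X : Type u} [TopologicalSpace X]

/-- A chain of plaques of `𝓤`: a finite sequence of plaques of charts in `𝓤`, each of which meets
the next one. -/
def IsPlaqueChain (𝓤 : Set (FoliatedChart X)) (L : List (Set X)) : Prop :=
  (∀ P ∈ L, ∃ c ∈ 𝓤, ∃ s : c.S, P = c.plaque s) ∧
    L.IsChain (fun P Q => (P ∩ Q).Nonempty)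

/-- The length of the path `σ`, restricted to `[0, 1]`, relative to `𝓤`: the least number of
plaques in a chain of plaques of `𝓤` that covers it (`⊤` if there is none). -/
noncomputable def pathLength (𝓤 : Set (FoliatedChart X)) (σ : ℝ → X) : ℕ∞ :=
  ⨅ (L : List (Set X)) (_ : IsPlaqueChain 𝓤 L ∧ σ '' Icc 0 1 ⊆ ⋃ P ∈ L, P), (L.length : ℕ∞)

/-- The length of a deformation of `U`: the supremum of the lengths of its leafwise paths. -/
noncomputable def deformationLength (𝓤 : Set (FoliatedChart X)) (U : Set X) (H : X → ℝ → X) : ℕ∞ :=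
  ⨆ x ∈ U, pathLength 𝓤 (H x)

end Length

/-! ### Transverse invariant measures -/

/-- `g` is a holonomy transformation between the transverse spaces of `c` and `d`: it is locally
given by the coordinate change from `c` to `d`. -/
def FoliatedChart.IsHolonomy {X : Type u} [TopologicalSpace X] (c d : FoliatedChart X)
    (g : OpenPartialHomeomorph c.S d.S) : Prop :=
  ∀ s ∈ g.source, ∃ x ∈ c.dom ∩ d.dom, c.proj x = s ∧ ∀ᶠ y in 𝓝 x, d.proj y = g (c.proj y)

/-- A transverse invariant measure: a Borel measure on the disjoint union of the transverse spaces
of the charts, invariant by the holonomy transformations, which generate the holonomy pseudogroup. -/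
structure TransverseInvariantMeasure {X : Type u} [TopologicalSpace X] (F : Lamination X) where
  μ : (c : F.charts) → Measure c.1.S
  invariant : ∀ (c d : F.charts) (g : OpenPartialHomeomorph c.1.S d.1.S), c.1.IsHolonomy d.1 g →
    ∀ A : Set c.1.S, MeasurableSet A → A ⊆ g.source → μ d (g '' A) = μ c A

namespace TransverseInvariantMeasure

variable {X : Type u} [TopologicalSpace X] {F : Lamination X}

/-- Finiteness on compact sets. -/
def FiniteOnCompacts (Λ : TransverseInvariantMeasure F) : Prop :=
  ∀ (c : F.charts) (K : Set c.1.S), IsCompact K → Λ.μ c K < ∞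

/-- Regularity: the measure of each Borel set is the infimum of the measures of the open sets that
contain it and the supremum of the measures of the compact sets that it contains. -/
def IsRegular (Λ : TransverseInvariantMeasure F) : Prop :=
  ∀ (c : F.charts) (A : Set c.1.S), MeasurableSet A →
    Λ.μ c A = (⨅ (O : Set c.1.S) (_ : A ⊆ O ∧ IsOpen O), Λ.μ c O) ∧
    Λ.μ c A = ⨆ (K : Set c.1.S) (_ : K ⊆ A ∧ IsCompact K), Λ.μ c K

/-- The extension of `Λ` to transverse sets `B`. Finitely many disjoint Borel pieces of `B` are
measured in charts whose projections are injective on them, and the supremum is taken. If `B` is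
Borel and meets each leaf in a countable set, then `B` has a countable partition into such pieces
and, by invariance, the supremum is the sum of their measures. -/
noncomputable def measure (Λ : TransverseInvariantMeasure F) (B : Set X) : ℝ≥0∞ :=
  ⨆ (k : ℕ) (c : Fin k → F.charts) (D : Fin k → Set X)
    (_ : (∀ i, MeasurableSet[borel X] (D i) ∧ D i ⊆ B ∩ (c i).1.dom ∧
        InjOn (c i).1.proj (D i)) ∧ Pairwise (fun i j => Disjoint (D i) (D j))),
    ∑ i, Λ.μ (c i) ((c i).1.proj '' D i)

end TransverseInvariantMeasure

/-! ### The `Λ`-category and its version with bounded lengths -/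

namespace Lamination

variable {X : Type u} [TopologicalSpace X]

/-- `τ_Λ(U)`: the infimum of `Λ(H(U × {1}))` over the tangential contractions `H` of `U`. -/
noncomputable def tau (F : Lamination X) (Λ : TransverseInvariantMeasure F) (U : Set X) : ℝ≥0∞ :=
  ⨅ (H : X → ℝ → X) (_ : F.IsTangentialContraction U H), Λ.measure ((fun x => H x 1) '' U)

/-- The `Λ`-category `Cat(F, Λ)`. -/
noncomputable def cat (F : Lamination X) (Λ : TransverseInvariantMeasure F) : ℝ≥0∞ :=
  ⨅ (𝓒 : Set (Set X)) (_ : (∀ U ∈ 𝓒, F.IsCategorical U) ∧ ⋃₀ 𝓒 = univ),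
    ∑' U : 𝓒, F.tau Λ (U : Set X)

/-- `U` is categorical through a tangential contraction of length at most `n` relative to `𝓤`. -/
def IsCategoricalLe (F : Lamination X) (n : ℕ) (𝓤 : Set (FoliatedChart X)) (U : Set X) : Prop :=
  IsOpen U ∧ ∃ H, F.IsTangentialContraction U H ∧ deformationLength 𝓤 U H ≤ n

/-- The version of `τ_Λ(U)` that uses only tangential contractions of length at most `n`. -/
noncomputable def tauLe (F : Lamination X) (Λ : TransverseInvariantMeasure F) (n : ℕ)
    (𝓤 : Set (FoliatedChart X)) (U : Set X) : ℝ≥0∞ :=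
  ⨅ (H : X → ℝ → X) (_ : F.IsTangentialContraction U H ∧ deformationLength 𝓤 U H ≤ n),
    Λ.measure ((fun x => H x 1) '' U)

/-- `Cat(F, Λ, n, 𝓤)`: the `Λ`-category computed with tangential contractions of length at most
`n` relative to `𝓤`. -/
noncomputable def catLe (F : Lamination X) (Λ : TransverseInvariantMeasure F) (n : ℕ)
    (𝓤 : Set (FoliatedChart X)) : ℝ≥0∞ :=
  ⨅ (𝓒 : Set (Set X)) (_ : (∀ U ∈ 𝓒, F.IsCategoricalLe n 𝓤 U) ∧ ⋃₀ 𝓒 = univ),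
    ∑' U : 𝓒, F.tauLe Λ n 𝓤 (U : Set X)

theorem catLe_antitone (F : Lamination X) (Λ : TransverseInvariantMeasure F)
    (𝓤 : Set (FoliatedChart X)) : Antitone (fun n => F.catLe Λ n 𝓤) := by
  intro m n hmn
  have hc : (m : ℕ∞) ≤ n := by exact_mod_cast hmn
  have htau : ∀ U : Set X, F.tauLe Λ n 𝓤 U ≤ F.tauLe Λ m 𝓤 U := fun U =>
    le_iInf₂ fun H hH => iInf₂_le H ⟨hH.1, hH.2.trans hc⟩
  refine le_iInf₂ fun 𝓒 h𝓒 => ?_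
  have hcov : (∀ U ∈ 𝓒, F.IsCategoricalLe n 𝓤 U) ∧ ⋃₀ 𝓒 = univ := by
    refine ⟨fun U hU => ?_, h𝓒.2⟩
    obtain ⟨hO, H, hH, hl⟩ := h𝓒.1 U hU
    exact ⟨hO, H, hH, hl.trans hc⟩
  exact (iInf₂_le 𝓒 hcov).trans (ENNReal.tsum_le_tsum fun U => htau U)

end Lamination

/-! ### Growth types -/

/-- Non-decreasing sequences of values in `[0, ∞]`. The value `∞` is admitted because
`1 / Cat(F, Λ, n, 𝓤)` is infinite when `Cat(F, Λ, n, 𝓤) = 0`. -/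
structure GrowthSeq where
  seq : ℕ → ℝ≥0∞
  mono : Monotone seq

/-- `g ≼ h` when there are `B ∈ ℕ` and a real `A > 0` with `g n ≤ A * h (B * n)` for all `n`. -/
instance : Preorder GrowthSeq where
  le g h := ∃ B : ℕ, ∃ A : ℝ≥0, 0 < A ∧ ∀ n, g.seq n ≤ (A : ℝ≥0∞) * h.seq (B * n)
  le_refl g := ⟨1, 1, one_pos, fun n => by simp⟩
  le_trans g h k := by
    rintro ⟨B, A, hA, h1⟩ ⟨B', A', hA', h2⟩
    refine ⟨B' * B, A * A', mul_pos hA hA', fun n => (h1 n).trans ?_⟩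
    rw [ENNReal.coe_mul, mul_assoc, mul_assoc]
    exact mul_le_mul_right (h2 (B * n)) _

/-- Growth types: non-decreasing sequences up to `g ≼ h ≼ g`. -/
abbrev GrowthType : Type := Antisymmetrization GrowthSeq (· ≤ ·)

/-- The secondary `Λ`-category `Cat_II(F, Λ, 𝓤)`: the growth type of `1 / Cat(F, Λ, n, 𝓤)`. -/
noncomputable def Lamination.secondaryCat {X : Type u} [TopologicalSpace X] (F : Lamination X)
    (Λ : TransverseInvariantMeasure F) (𝓤 : Set (FoliatedChart X)) : GrowthType :=
  toAntisymmetrization (· ≤ ·)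
    ⟨fun n => (F.catLe Λ n 𝓤)⁻¹, fun _ _ h => ENNReal.inv_le_inv.2 (F.catLe_antitone Λ 𝓤 h)⟩

/-! Changing the atlas changes leafwise lengths by at most a constant factor. By compactness,
finitely many open sets cover `X` on each of which some chart of `𝓤` and some chart of `𝓥` have the
same local plaques. Regularity of `𝓤` puts the trace of a plaque `P` of `𝓤` on such a set inside one
plaque of `𝓥`, so a bounded number of plaques of `𝓥` cover `P` (`exists_finite_plaque_cover`). As
`P` is connected and these plaques are relatively open in it, their intersection graph is connected;
a walk visiting all its vertices is a chain covering `P`, of bounded length and with prescribed ends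
(`exists_chain_cover_plaque`). Concatenation along a chain of `𝓤` gives the factor `K`, hence
Cat(Kn, `𝓥`) ≤ Cat(n, `𝓤`). Inverting, and exchanging the atlases, gives both growth inequalities.
-/

/-- A connected graph with finitely many vertices has a walk of bounded length between any two given
vertices that visits all the vertices of a given list. -/
theorem SimpleGraph.Preconnected.exists_walk_visiting {ι : Type*} [Fintype ι] {G : SimpleGraph ι}
    (hG : G.Preconnected) (l : List ι) (a b : ι) :
    ∃ w : G.Walk a b, (∀ i ∈ l, i ∈ w.support) ∧
      w.length ≤ (l.length + 1) * Fintype.card ι := by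
  induction l generalizing a with
  | nil =>
    obtain ⟨p, hp⟩ := (hG a b).exists_isPath
    exact ⟨p, by simp, by simpa using hp.length_lt.le⟩
  | cons i l ih =>
    -- Each vertex to visit costs one more path, which has fewer edges than the graph has vertices.
    obtain ⟨p, hp⟩ := (hG a i).exists_isPath
    obtain ⟨w, hw, hlen⟩ := ih i
    refine ⟨p.append w, ?_, ?_⟩
    · intro j hj
      rw [SimpleGraph.Walk.mem_support_append_iff]
      rcases List.mem_cons.1 hj with rfl | hj
      · exact Or.inl p.end_mem_support
      · exact Or.inr (hw j hj)
    · rw [SimpleGraph.Walk.length_append, List.length_cons, add_one_mul (l.length + 1)]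
      have := hp.length_lt
      omega

/-! ### Nerves of covers of connected sets -/

section Connectedness

variable {X : Type*} [TopologicalSpace X]

/-- The nerve of a cover of a preconnected set by relatively open sets is connected. -/
theorem IsPreconnected.preconnected_fromRel {P : Set X} (hP : IsPreconnected P) {ι : Type*}
    {Q : ι → Set X} (hne : ∀ i, (P ∩ Q i).Nonempty)
    (hopen : ∀ i, ∀ x ∈ P ∩ Q i, Q i ∈ 𝓝[P] x) (hcov : P ⊆ ⋃ i, Q i) :
    (SimpleGraph.fromRel fun i j => (Q i ∩ Q j).Nonempty).Preconnected := by
  have hmeet : ∀ i j, (Q i ∩ Q j).Nonempty →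
      (SimpleGraph.fromRel fun i j => (Q i ∩ Q j).Nonempty).Reachable i j := by
    intro i j h
    by_cases hij : i = j
    · subst hij
      exact SimpleGraph.Reachable.refl _
    · exact SimpleGraph.Adj.reachable ((SimpleGraph.fromRel_adj _ _ _).2 ⟨hij, Or.inl h⟩)
  intro i j
  obtain ⟨x, hx, hxi⟩ := hne i
  obtain ⟨y, hy, hyj⟩ := hne j
  -- Lying only in members of the same component of the nerve is a symmetric relation between
  -- points; it is transitive because some member contains the middle point, and it holds locally
  -- because members are relatively open.
  refine hP.induction₂ (fun x y => ∀ i j, x ∈ Q i → y ∈ Q j →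
    (SimpleGraph.fromRel fun i j => (Q i ∩ Q j).Nonempty).Reachable i j) ?_ ?_ ?_
    hx hy i j hxi hyj
  · intro x hx
    obtain ⟨k, hk⟩ := mem_iUnion.1 (hcov hx)
    filter_upwards [hopen k x ⟨hx, hk⟩] with y hy i j hi hj
    exact (hmeet i k ⟨x, hi, hk⟩).trans (hmeet k j ⟨y, hy, hj⟩)
  · intro x y z _ hy _ hxy hyz i j hi hj
    obtain ⟨k, hk⟩ := mem_iUnion.1 (hcov hy)
    exact (hxy i k hi hk).trans (hyz k j hk hj)
  · intro x y _ _ h i j hi hj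
    exact (h j i hj hi).symm

end Connectedness

/-! ### Topology of plaques -/

namespace FoliatedChart

variable {X : Type u} [TopologicalSpace X]

theorem isPreconnected_plaque (c : FoliatedChart X) (s : c.S) : IsPreconnected (c.plaque s) := by
  have himage : c.plaque s = c.φ.symm '' (Metric.ball c.center c.radius ×ˢ {s}) := by
    ext x
    constructor
    · rintro ⟨hx, hs⟩
      have ht := c.φ.map_source hx
      rw [c.target_eq] at ht
      exact ⟨c.φ x, ⟨ht.1, hs⟩, c.φ.left_inv hx⟩
    · rintro ⟨p, ⟨hp, hs⟩, rfl⟩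
      have ht : p ∈ c.φ.target := by
        rw [c.target_eq]
        exact ⟨hp, mem_univ _⟩
      refine ⟨c.φ.map_target ht, ?_⟩
      change (c.φ (c.φ.symm p)).2 = s
      rw [c.φ.right_inv ht]
      exact hs
  rw [himage]
  refine ((convex_ball _ _).isPreconnected.prod isPreconnected_singleton).image _
    (c.φ.continuousOn_symm.mono ?_)
  rw [c.target_eq]
  exact prod_mono_right (subset_univ _)

/-- The plaques of a compatible chart are relatively open in each plaque. -/
theorem Compatible.plaque_mem_nhdsWithin {c d : FoliatedChart X} (h : c.Compatible d) {s : c.S}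
    {t : d.S} {x : X} (hx : x ∈ c.plaque s ∩ d.plaque t) :
    d.plaque t ∈ 𝓝[c.plaque s] x := by
  obtain ⟨N, hN, hxN, hsub, hiff⟩ := h x ⟨hx.1.1, hx.2.1⟩
  refine mem_nhdsWithin.2 ⟨N, hN, hxN, fun y hy => ⟨(hsub hy.1).2, ?_⟩⟩
  exact ((hiff y hy.1 x hxN).1 (hy.2.2.trans hx.1.2.symm)).trans hx.2.2

end FoliatedChart

/-! ### Comparison of two atlases -/

namespace Lamination.IsFiniteRegularAtlas

variable {X : Type u} [TopologicalSpace X] {F : Lamination X} {𝓤 𝓥 : Set (FoliatedChart X)}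

/-- Each plaque of `𝓤` is covered by a bounded number of plaques of `𝓥`. -/
theorem exists_finite_plaque_cover [CompactSpace X] (h𝓤 : F.IsFiniteRegularAtlas 𝓤)
    (h𝓥 : F.IsFiniteRegularAtlas 𝓥) :
    ∃ k : ℕ, ∀ c ∈ 𝓤, ∀ s : c.S, ∃ T : Finset (Set X), T.card ≤ k ∧
      (∀ Q ∈ T, (∃ d ∈ 𝓥, ∃ t : d.S, Q = d.plaque t) ∧ (c.plaque s ∩ Q).Nonempty) ∧
      c.plaque s ⊆ ⋃ Q ∈ T, Q := by
  classical
  choose c hc hxc using h𝓤.covers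
  choose d hd hxd using h𝓥.covers
  choose N hN hxN hsub hiff using fun x =>
    F.compatible _ (h𝓤.subset (hc x)) _ (h𝓥.subset (hd x)) x ⟨hxc x, hxd x⟩
  obtain ⟨I, hI⟩ := isCompact_univ.elim_finite_subcover N hN
    fun x _ => mem_iUnion.2 ⟨x, hxN x⟩
  -- The finite subcover is chosen before the plaque, so its cardinality is a uniform bound.
  refine ⟨I.card, fun e he s => ?_⟩
  have hplaque : ∀ x, ∃ Q : Set X, (e.plaque s ∩ N x).Nonempty →
      (∃ b ∈ 𝓥, ∃ t : b.S, Q = b.plaque t) ∧ (e.plaque s ∩ Q).Nonempty ∧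
        e.plaque s ∩ N x ⊆ Q := by
    intro x
    by_cases hne : (e.plaque s ∩ N x).Nonempty
    · obtain ⟨z, hz, hzN⟩ := hne
      obtain ⟨r, hr⟩ := h𝓤.plaque_inter e he (c x) (hc x) s ⟨z, hz, (hsub x hzN).1⟩
      refine ⟨(d x).plaque ((d x).proj z), fun _ => ⟨⟨d x, hd x, _, rfl⟩,
        ⟨z, hz, (hsub x hzN).2, rfl⟩, fun y hy => ⟨(hsub x hy.2).2, ?_⟩⟩⟩
      -- Points of the plaque in `N x` share a plaque of `c x` by regularity, hence one of `d x`.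
      refine (hiff x y hy.2 z hzN).1 ?_
      exact (hr ⟨hy.1, (hsub x hy.2).1⟩).2.trans (hr ⟨hz, (hsub x hzN).1⟩).2.symm
    -- Junk value, discarded by the filter on `I` below.
    · exact ⟨∅, fun h => (hne h).elim⟩
  choose Q hQ using hplaque
  refine ⟨(I.filter fun x => (e.plaque s ∩ N x).Nonempty).image Q,
    Finset.card_image_le.trans (Finset.card_filter_le _ _), ?_, ?_⟩
  · intro R hR
    obtain ⟨x, hx, rfl⟩ := Finset.mem_image.1 hR
    have h := hQ x (Finset.mem_filter.1 hx).2
    exact ⟨h.1, h.2.1⟩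
  · intro y hy
    obtain ⟨x, hxI, hyx⟩ := mem_iUnion₂.1 (hI (mem_univ y))
    have hne : (e.plaque s ∩ N x).Nonempty := ⟨y, hy, hyx⟩
    exact mem_iUnion₂.2 ⟨Q x, Finset.mem_image_of_mem Q (Finset.mem_filter.2 ⟨hxI, hne⟩),
      (hQ x hne).2.2 ⟨hy, hyx⟩⟩

/-- Each plaque of `𝓤` is covered by a chain of plaques of `𝓥` of bounded length, which can be made
to start and to end at given points. -/
theorem exists_chain_cover_plaque [CompactSpace X] (h𝓤 : F.IsFiniteRegularAtlas 𝓤)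
    (h𝓥 : F.IsFiniteRegularAtlas 𝓥) :
    ∃ K : ℕ, ∀ c ∈ 𝓤, ∀ s : c.S, ∀ x ∈ c.plaque s, ∀ y ∈ c.plaque s,
      ∃ L : List (Set X), IsPlaqueChain 𝓥 L ∧ (∃ Q ∈ L.head?, x ∈ Q) ∧
        (∀ Q ∈ L.getLast?, y ∈ Q) ∧ c.plaque s ⊆ (⋃ Q ∈ L, Q) ∧ L.length ≤ K := by
  obtain ⟨k, hk⟩ := h𝓤.exists_finite_plaque_cover h𝓥
  -- The walk has at most `(k + 1) * k` edges, and one more vertex than edges.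
  refine ⟨(k + 1) * k + 1, fun c hc s x hx y hy => ?_⟩
  obtain ⟨T, hcard, hT, hcov⟩ := hk c hc s
  have hG := (c.isPreconnected_plaque s).preconnected_fromRel (Q := fun i : T => (i : Set X))
    (fun i => (hT i i.2).2) (fun i z hz => by
      obtain ⟨d, hd, t, ht⟩ := (hT i i.2).1
      rw [ht] at hz ⊢
      exact (F.compatible c (h𝓤.subset hc) d (h𝓥.subset hd)).plaque_mem_nhdsWithin hz)
    (fun z hz => by
      obtain ⟨Q, hQ, hzQ⟩ := mem_iUnion₂.1 (hcov hz)
      exact mem_iUnion.2 ⟨⟨Q, hQ⟩, hzQ⟩)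
  obtain ⟨A, hA, hxA⟩ := mem_iUnion₂.1 (hcov hx)
  obtain ⟨B, hB, hyB⟩ := mem_iUnion₂.1 (hcov hy)
  obtain ⟨w, hw, hlen⟩ := hG.exists_walk_visiting Finset.univ.toList ⟨A, hA⟩ ⟨B, hB⟩
  refine ⟨w.support.map Subtype.val, ⟨?_, ?_⟩, ⟨A, ?_, hxA⟩, ?_, ?_, ?_⟩
  · intro P hP
    obtain ⟨i, -, rfl⟩ := List.mem_map.1 hP
    exact (hT i i.2).1
  · rw [List.isChain_map]
    refine w.isChain_adj_support.imp fun i j hij => ?_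
    rcases ((SimpleGraph.fromRel_adj _ _ _).1 hij).2 with h | h
    · exact h
    · rwa [inter_comm]
  · rw [List.head?_map, List.head?_eq_some_head w.support_ne_nil, w.head_support]
    rfl
  · intro Q hQ
    rw [List.getLast?_map, List.getLast?_eq_some_getLast w.support_ne_nil, w.getLast_support] at hQ
    obtain rfl : B = Q := by simpa using hQ
    exact hyB
  · intro z hz
    obtain ⟨Q, hQ, hzQ⟩ := mem_iUnion₂.1 (hcov hz)
    exact mem_iUnion₂.2 ⟨Q, List.mem_map.2 ⟨⟨Q, hQ⟩, hw _ (by simp), rfl⟩, hzQ⟩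
  · rw [List.length_map, SimpleGraph.Walk.length_support]
    rw [Finset.length_toList, Finset.card_univ, Fintype.card_coe] at hlen
    have : (T.card + 1) * T.card ≤ (k + 1) * k := by gcongr
    omega

/-- Consecutive plaques share a point; the covering chains of the two plaques are made to end and to
start there, so that they can be concatenated. -/
theorem exists_chain_cover_chain [CompactSpace X] (h𝓤 : F.IsFiniteRegularAtlas 𝓤)
    (h𝓥 : F.IsFiniteRegularAtlas 𝓥) :
    ∃ K : ℕ, ∀ L : List (Set X), IsPlaqueChain 𝓤 L → (⋃ P ∈ L, P).Nonempty →
      ∃ L' : List (Set X), IsPlaqueChain 𝓥 L' ∧ (⋃ P ∈ L, P) ⊆ (⋃ Q ∈ L', Q) ∧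
        L'.length ≤ K * L.length := by
  obtain ⟨K, hK⟩ := h𝓤.exists_chain_cover_plaque h𝓥
  -- The induction prescribes a point of the first plaque of `L'`, to be glued to what precedes.
  have key : ∀ (L : List (Set X)) (P : Set X), IsPlaqueChain 𝓤 (P :: L) → ∀ x ∈ P,
      ∃ L' : List (Set X), IsPlaqueChain 𝓥 L' ∧ (∃ Q ∈ L'.head?, x ∈ Q) ∧
        (⋃ R ∈ P :: L, R) ⊆ (⋃ Q ∈ L', Q) ∧ L'.length ≤ K * (P :: L).length := by
    intro L
    induction L with
    | nil =>
      intro P hP x hx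
      obtain ⟨c, hc, s, rfl⟩ := hP.1 P List.mem_cons_self
      obtain ⟨L', hL', hhead, -, hcov, hlen⟩ := hK c hc s x hx x hx
      exact ⟨L', hL', hhead, by simpa using hcov, by simpa using hlen⟩
    | cons R L ih =>
      intro P hP x hx
      obtain ⟨c, hc, s, rfl⟩ := hP.1 P List.mem_cons_self
      obtain ⟨⟨y, hyP, hyR⟩, hchain⟩ := List.isChain_cons_cons.1 hP.2
      obtain ⟨L₁, hL₁, ⟨Q, hQ, hxQ⟩, hlast, hcov₁, hlen₁⟩ := hK c hc s x hx y hyP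
      obtain ⟨L₂, hL₂, ⟨Q', hQ', hyQ'⟩, hcov₂, hlen₂⟩ :=
        ih R ⟨fun S hS => hP.1 S (List.mem_cons_of_mem _ hS), hchain⟩ y hyR
      refine ⟨L₁ ++ L₂, ⟨?_, ?_⟩, ⟨Q, List.mem_head?_append_of_mem_head? hQ, hxQ⟩, ?_, ?_⟩
      · intro S hS
        exact (List.mem_append.1 hS).elim (hL₁.1 S) (hL₂.1 S)
      · refine List.isChain_append.2 ⟨hL₁.2, hL₂.2, fun A hA B hB => ⟨y, hlast A hA, ?_⟩⟩
        rwa [Option.mem_unique hB hQ']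
      · intro z hz
        obtain ⟨S, hS, hzS⟩ := mem_iUnion₂.1 hz
        rcases List.mem_cons.1 hS with rfl | hS
        · obtain ⟨A, hA, hzA⟩ := mem_iUnion₂.1 (hcov₁ hzS)
          exact mem_iUnion₂.2 ⟨A, List.mem_append_left _ hA, hzA⟩
        · obtain ⟨A, hA, hzA⟩ := mem_iUnion₂.1 (hcov₂ (mem_iUnion₂.2 ⟨S, hS, hzS⟩))
          exact mem_iUnion₂.2 ⟨A, List.mem_append_right _ hA, hzA⟩
      · rw [List.length_append, List.length_cons, mul_add_one]
        omega
  refine ⟨K, fun L hL hne => ?_⟩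
  cases L with
  | nil => simp at hne
  | cons P L =>
    obtain ⟨c, hc, s, hP⟩ := hL.1 P List.mem_cons_self
    -- The first plaque has a point: it meets the next one, or it is the whole union.
    by_cases hPne : P.Nonempty
    · obtain ⟨x, hx⟩ := hPne
      obtain ⟨L', hL', -, h⟩ := key L P hL x hx
      exact ⟨L', hL', h⟩
    · cases L with
      | nil =>
        obtain ⟨x, hx⟩ := hne
        exact (hPne ⟨x, by simpa using hx⟩).elim
      | cons R L => exact (hPne (List.isChain_cons_cons.1 hL.2).1.left).elim

/-- Lengths relative to two finite regular atlases are comparable. -/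
theorem exists_pathLength_le [CompactSpace X] (h𝓤 : F.IsFiniteRegularAtlas 𝓤)
    (h𝓥 : F.IsFiniteRegularAtlas 𝓥) :
    ∃ K : ℕ, ∀ (σ : ℝ → X) (n : ℕ), pathLength 𝓤 σ ≤ n → pathLength 𝓥 σ ≤ (K * n : ℕ) := by
  obtain ⟨K, hK⟩ := h𝓤.exists_chain_cover_chain h𝓥
  refine ⟨K, fun σ n hn => ?_⟩
  -- A strict bound extracts a chain from the infimum; in integers it still has at most `n` plaques.
  have hlt : pathLength 𝓤 σ < (n + 1 : ℕ) := hn.trans_lt (by exact_mod_cast n.lt_succ_self)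
  obtain ⟨L, hL⟩ := iInf_lt_iff.1 hlt
  obtain ⟨⟨hchain, hcov⟩, hlen⟩ := iInf_lt_iff.1 hL
  have hlen : L.length ≤ n := Nat.lt_succ_iff.1 (by exact_mod_cast hlen)
  obtain ⟨L', hL', hcov', hlen'⟩ :=
    hK L hchain ⟨σ 0, hcov (mem_image_of_mem σ (left_mem_Icc.2 zero_le_one))⟩
  refine (iInf₂_le L' ⟨hL', hcov.trans hcov'⟩).trans ?_
  exact_mod_cast hlen'.trans (Nat.mul_le_mul_left K hlen)

/-- The same coverings and contractions, with the same measures, are admissible on both sides once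
the length bound is multiplied by `K`. -/
theorem exists_catLe_mul_le [CompactSpace X] (h𝓤 : F.IsFiniteRegularAtlas 𝓤)
    (h𝓥 : F.IsFiniteRegularAtlas 𝓥) (Λ : TransverseInvariantMeasure F) :
    ∃ K : ℕ, ∀ n, F.catLe Λ (K * n) 𝓥 ≤ F.catLe Λ n 𝓤 := by
  obtain ⟨K, hK⟩ := h𝓤.exists_pathLength_le h𝓥
  have hdef : ∀ (n : ℕ) (U : Set X) (H : X → ℝ → X), deformationLength 𝓤 U H ≤ n →
      deformationLength 𝓥 U H ≤ (K * n : ℕ) := fun n U H h =>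
    iSup₂_le fun x hx => hK (H x) n ((le_iSup₂ (f := fun x _ => pathLength 𝓤 (H x)) x hx).trans h)
  refine ⟨K, fun n => le_iInf₂ fun 𝓒 h𝓒 => ?_⟩
  refine (iInf₂_le 𝓒 ⟨fun U hU => ?_, h𝓒.2⟩).trans (ENNReal.tsum_le_tsum fun U =>
    le_iInf₂ fun H hH => iInf₂_le H ⟨hH.1, hdef n U H hH.2⟩)
  obtain ⟨hO, H, hH, hl⟩ := h𝓒.1 U hU
  exact ⟨hO, H, hH, hdef n U H hl⟩

end Lamination.IsFiniteRegularAtlas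

theorem propositionp {X : Type u} [TopologicalSpace X] [PolishSpace X] [CompactSpace X]
    (F : Lamination X) (Λ : TransverseInvariantMeasure F)
    (hreg : Λ.IsRegular) (hfin : Λ.FiniteOnCompacts) (hcat : F.cat Λ = 0)
    (𝓤 𝓥 : Set (FoliatedChart X))
    (h𝓤 : F.IsFiniteRegularAtlas 𝓤) (h𝓥 : F.IsFiniteRegularAtlas 𝓥) :
    F.secondaryCat Λ 𝓤 = F.secondaryCat Λ 𝓥 := by
  obtain ⟨K, hK⟩ := h𝓤.exists_catLe_mul_le h𝓥 Λ
  obtain ⟨K', hK'⟩ := h𝓥.exists_catLe_mul_le h𝓤 Λ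
  -- The atlas only rescales `n`, so the multiplicative constant of the growth relation is 1.
  refine Quotient.sound ⟨⟨K, 1, one_pos, fun n => ?_⟩, ⟨K', 1, one_pos, fun n => ?_⟩⟩
  · simpa using hK n
  · simpa using hK' n
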